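/- Let $V=\{V_n\}_{n\in\mathbb Z}\in\ell^\infty(\mathbb Z)$ be a bounded sequence of real numbers, and let $H=-\Delta+V$ be the discrete Schrödinger operator on $\ell^2(\mathbb Z^2)$ (complex-valued square-summable sequences $\psi=\{\psi_{n,m}\}$) given by $$(H\psi)_{n,m}=-(\psi_{n+1,m}+\psi_{n-1,m}+\psi_{n,m+1}+\psi_{n,m-1})+V_n\psi_{n,m},\qquad (n,m)\in\mathbb Z^2,$$ so that the potential is independent of $m$. Then $H$ is a bounded self-adjoint operator with purely absolutely continuous spectrum: for every $\psi\in\ell^2(\mathbb Z^2)$ the spectral measure $\mu_\psi$ of $H$ at $\psi$, that is, the finite Borel measure on $\mathbb R$ with $\int f\,d\mu_\psi=\langle \psi, f(H)\psi\rangle$ for all continuous compactly supported $f:\mathbb R\to\mathbb R$ (equivalently $\mu_\psi(B)=\langle P(B)\psi,\psi\rangle$ with $P$ the projection-valued measure of $H$), is absolutely continuous with respect to Lebesgue measure. -/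

import Mathlib

open MeasureTheory CompactlySupported
open scoped ENNReal

noncomputable section

section SpectralMeasure

variable {E : Type*} [NormedAddCommGroup E] [InnerProductSpace ℂ E] [CompleteSpace E]

/-- For a bounded self-adjoint operator `T` and a vector `ψ`, the positive linear functional
`f ↦ ⟨ψ, f(T) ψ⟩` on compactly supported continuous functions `f : ℝ → ℝ`, where `f(T)` is given by
the continuous functional calculus. (The number `⟨ψ, f(T) ψ⟩` is real, as `f(T)` is
self-adjoint.) -/
def spectralFunctional (T : E →L[ℂ] E) (_hT : IsSelfAdjoint T) (ψ : E) :
    C_c(ℝ, ℝ) →ₚ[ℝ] ℝ :=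
  PositiveLinearMap.mk₀
    { toFun := fun f => (inner ℂ ψ (cfc (f : ℝ → ℝ) T ψ)).re
      map_add' := fun f g => by
        have h : cfc (⇑(f + g)) T = cfc (⇑f) T + cfc (⇑g) T :=
          cfc_add T (⇑f) (⇑g) f.continuous.continuousOn g.continuous.continuousOn
        rw [h, add_apply, inner_add_right, Complex.add_re]
      map_smul' := fun c f => by
        have h : cfc (⇑(c • f)) T = c • cfc (⇑f) T :=
          cfc_smul c (⇑f) T f.continuous.continuousOn
        rw [h, smul_apply, ← Complex.coe_smul, inner_smul_right]
        simp }
    (fun f hf => by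
      have h : 0 ≤ cfc (⇑f) T := cfc_nonneg fun x _ => hf x
      have h' := (ContinuousLinearMap.nonneg_iff_isPositive _).1 h
      exact (Complex.le_def.1 (h'.inner_nonneg_right ψ)).1)

/-- The spectral measure of the bounded self-adjoint operator `T` at the vector `ψ`: the Borel
measure `μ` on `ℝ` with `∫ f dμ = ⟨ψ, f(T) ψ⟩`, obtained from the Riesz–Markov–Kakutani theorem.
In terms of the projection-valued measure `P` of `T` it is `B ↦ ⟨P(B) ψ, ψ⟩`. -/
def spectralMeasure (T : E →L[ℂ] E) (hT : IsSelfAdjoint T) (ψ : E) : Measure ℝ :=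
  RealRMK.rieszMeasure (spectralFunctional T hT ψ)

/-- The defining property of the spectral measure. -/
theorem integral_spectralMeasure (T : E →L[ℂ] E) (hT : IsSelfAdjoint T) (ψ : E) (f : C_c(ℝ, ℝ)) :
    ∫ x, f x ∂(spectralMeasure T hT ψ) = (inner ℂ ψ (cfc (f : ℝ → ℝ) T ψ)).re :=
  RealRMK.integral_rieszMeasure (spectralFunctional T hT ψ) f

/-- A bounded operator has purely absolutely continuous spectrum if it is self-adjoint and all its
spectral measures are absolutely continuous with respect to Lebesgue measure. -/
def HasPurelyACSpectrum (T : E →L[ℂ] E) : Prop :=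
  ∃ hT : IsSelfAdjoint T, ∀ ψ : E, spectralMeasure T hT ψ ≪ (volume : Measure ℝ)

end SpectralMeasure

section Operator

theorem memℓp_two_comp_equiv {ι : Type*} (e : ι ≃ ι) {f : ι → ℂ} (hf : Memℓp f 2) :
    Memℓp (fun i => f (e i)) 2 := by
  have h2 : 0 < (2 : ℝ≥0∞).toReal := by norm_num
  rw [memℓp_gen_iff h2] at hf ⊢
  exact e.summable_iff.2 hf

theorem memℓp_two_shift {f : ℤ × ℤ → ℂ} (hf : Memℓp f 2) (a : ℤ × ℤ) :
    Memℓp (fun p => f (p + a)) 2 :=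
  memℓp_two_comp_equiv (Equiv.addRight a) hf

theorem memℓp_two_potential (V : lp (fun _ : ℤ => ℝ) ∞) {f : ℤ × ℤ → ℂ} (hf : Memℓp f 2) :
    Memℓp (fun p : ℤ × ℤ => (V p.1 : ℂ) * f p) 2 := by
  refine (hf.const_smul (‖V‖ : ℂ)).mono' fun p => ?_
  have h := lp.norm_apply_le_norm ENNReal.top_ne_zero V p.1
  simp only [Pi.smul_apply, smul_eq_mul, norm_mul, Complex.norm_real, norm_norm]
  gcongr

theorem memℓp_two_schrodinger (V : lp (fun _ : ℤ => ℝ) ∞) {f : ℤ × ℤ → ℂ} (hf : Memℓp f 2) :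
    Memℓp (fun p : ℤ × ℤ => -(f (p.1 + 1, p.2) + f (p.1 - 1, p.2) + f (p.1, p.2 + 1)
      + f (p.1, p.2 - 1)) + (V p.1 : ℂ) * f p) 2 := by
  have h := ((((memℓp_two_shift hf (1, 0)).add (memℓp_two_shift hf (-1, 0))).add
    (memℓp_two_shift hf (0, 1))).add (memℓp_two_shift hf (0, -1))).neg.add
    (memℓp_two_potential V hf)
  convert h using 1
  funext p
  simp [Prod.add_def, sub_eq_add_neg]

/-- The discrete Schrödinger operator `-Δ + V` on `ℓ²(ℤ²)` as a linear map:
`(Hψ)(n, m) = -(ψ(n+1, m) + ψ(n-1, m) + ψ(n, m+1) + ψ(n, m-1)) + V(n) ψ(n, m)`. -/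
def schrodingerLinear (V : lp (fun _ : ℤ => ℝ) ∞) :
    lp (fun _ : ℤ × ℤ => ℂ) 2 →ₗ[ℂ] lp (fun _ : ℤ × ℤ => ℂ) 2 where
  toFun ψ := ⟨fun p => -(ψ (p.1 + 1, p.2) + ψ (p.1 - 1, p.2) + ψ (p.1, p.2 + 1)
      + ψ (p.1, p.2 - 1)) + (V p.1 : ℂ) * ψ p,
    memℓp_two_schrodinger V ψ.2⟩
  map_add' ψ φ := by
    ext p
    simp only [lp.coeFn_add, Pi.add_apply]
    ring
  map_smul' c ψ := by
    ext p
    simp only [lp.coeFn_smul, Pi.smul_apply, smul_eq_mul, RingHom.id_apply]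
    ring

theorem schrodingerLinear_apply (V : lp (fun _ : ℤ => ℝ) ∞)
    (ψ : lp (fun _ : ℤ × ℤ => ℂ) 2) (p : ℤ × ℤ) :
    schrodingerLinear V ψ p = -(ψ (p.1 + 1, p.2) + ψ (p.1 - 1, p.2) + ψ (p.1, p.2 + 1)
      + ψ (p.1, p.2 - 1)) + (V p.1 : ℂ) * ψ p := rfl

theorem continuous_schrodingerLinear (V : lp (fun _ : ℤ => ℝ) ∞) :
    Continuous (schrodingerLinear V) := by
  refine (schrodingerLinear V).continuous_of_seq_closed_graph fun u x y hu hy => ?_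
  have ev : ∀ p : ℤ × ℤ, Continuous fun φ : lp (fun _ : ℤ × ℤ => ℂ) 2 => φ p := fun p =>
    (lp.evalCLM ℂ (fun _ : ℤ × ℤ => ℂ) 2 p).continuous
  ext p
  have h1 := ((ev p).tendsto y).comp hy
  have h2 : Continuous fun φ : lp (fun _ : ℤ × ℤ => ℂ) 2 => schrodingerLinear V φ p := by
    simp only [schrodingerLinear_apply]
    exact (((((ev _).add (ev _)).add (ev _)).add (ev _)).neg).add (continuous_const.mul (ev _))
  exact tendsto_nhds_unique h1 ((h2.tendsto x).comp hu)

/-- The discrete Schrödinger operator `-Δ + V` as a bounded operator on `ℓ²(ℤ²)`; the potential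
`V ∈ ℓ^∞(ℤ)` is real and depends on the first coordinate only. -/
def schrodinger (V : lp (fun _ : ℤ => ℝ) ∞) :
    lp (fun _ : ℤ × ℤ => ℂ) 2 →L[ℂ] lp (fun _ : ℤ × ℤ => ℂ) 2 :=
  ⟨schrodingerLinear V, continuous_schrodingerLinear V⟩

end Operator

end

/-! Since the potential ignores `m`, `H = K - U 1 - U (-1)`, where `U n` is vertical translation by
`n` and `K` (`horizontalOp`) acts within rows and commutes with every `U n`. If `ψ` is supported at
one site, `K ^ a ψ` stays in its row, so `⟨ψ, U n K ^ a ψ⟩ = 0` for `n ≠ 0`. In the state `ψ`, `U n`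
therefore behaves like `exp (i n θ)` with `θ` uniform and independent of `K`, and `H` has the law of
`x - 2 cos θ`, where `x` follows the spectral measure of `K` (`spectralMeasure_eq_cosConvolution`,
by comparing moments). As `cos` pulls null sets back to null sets, this law is absolutely continuous
whatever the law of `x`; nothing about `V` enters.

Vectors with absolutely continuous spectral measure are closed under sums and limits
(`add_mem_acVectors`, `isClosed_acVectors`), both by the quasi-triangle inequality
`spectralMeasure_add_le`; the point masses thus give all of `ℓ²`. -/

open scoped Polynomial

/-! ### Measures on the line: comparison, moments, null sets under cosine -/

/-- If the integrals of nonnegative compactly supported continuous functions against `μ` are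
bounded by those against `ν`, then `μ ≤ ν`. -/
theorem measure_le_of_integral_le {μ ν : Measure ℝ} [IsFiniteMeasure μ] [IsFiniteMeasure ν]
    (h : ∀ f : C_c(ℝ, ℝ), 0 ≤ f → ∫ x, f x ∂μ ≤ ∫ x, f x ∂ν) : μ ≤ ν := by
  have hK : ∀ K : Set ℝ, IsCompact K → μ K ≤ ν K := by
    intro K hK
    refine ENNReal.le_of_forall_pos_le_add fun ε hε _ => ?_
    obtain ⟨U, hKU, hU, hνU⟩ := K.exists_isOpen_le_add ν (ENNReal.coe_pos.2 hε).ne'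
    obtain ⟨f, hf1, hf2, hf3, hf4⟩ := exists_continuousMap_one_of_isCompact_subset_isOpen hK hU hKU
    let g : C_c(ℝ, ℝ) := ⟨f, hasCompactSupport_def.mpr hf2⟩
    have hg : ∀ x, g x = f x := fun _ => rfl
    have h1 : μ.real K ≤ ∫ x, g x ∂μ := by
      rw [← integral_indicator_one hK.measurableSet]
      refine integral_mono ((integrable_const 1).indicator hK.measurableSet) g.integrable ?_
      intro x
      by_cases hx : x ∈ K
      · simp [hx, hg, hf1 hx]
      · simpa [hx, hg] using (hf4 x).1
    have h2 : ∫ x, g x ∂ν ≤ ν.real U := by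
      rw [← integral_indicator_one hU.measurableSet]
      refine integral_mono g.integrable ((integrable_const 1).indicator hU.measurableSet) ?_
      intro x
      by_cases hx : x ∈ U
      · simpa [hx, hg] using (hf4 x).2
      · have : x ∉ tsupport f := fun hx' => hx (hf3 hx')
        simp [hx, hg, image_eq_zero_of_notMem_tsupport this]
    have h3 := h1.trans ((h g fun x => (hf4 x).1).trans h2)
    exact ((ENNReal.toReal_le_toReal (by finiteness) (by finiteness)).1 h3).trans hνU
  refine Measure.le_iff.2 fun s hs => ?_
  rw [hs.measure_eq_iSup_isCompact]
  exact iSup₂_le fun K hKs => iSup_le fun hKc => (hK K hKc).trans (measure_mono hKs)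

/-- Finite Borel measures carried by a common bounded interval and having the same moments are
equal. -/
theorem measure_ext_of_moments {μ ν : Measure ℝ} [IsFiniteMeasure μ] [IsFiniteMeasure ν] (R : ℝ)
    (hμ : ∀ᵐ x ∂μ, x ∈ Set.Icc (-R) R) (hν : ∀ᵐ x ∂ν, x ∈ Set.Icc (-R) R)
    (h : ∀ k : ℕ, ∫ x, x ^ k ∂μ = ∫ x, x ^ k ∂ν) : μ = ν := by
  have hcont : ∀ (ρ : Measure ℝ) [IsFiniteMeasure ρ], (∀ᵐ x ∂ρ, x ∈ Set.Icc (-R) R) →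
      ∀ f : ℝ → ℝ, Continuous f → Integrable f ρ := by
    intro ρ _ hρ f hf
    rw [← Measure.restrict_eq_self_of_ae_mem hρ]
    exact hf.continuousOn.integrableOn_compact isCompact_Icc
  have hpoly : ∀ p : ℝ[X], ∫ x, p.eval x ∂μ = ∫ x, p.eval x ∂ν := by
    intro p
    induction p using Polynomial.induction_on' with
    | add p q hp hq =>
      simp only [Polynomial.eval_add]
      rw [integral_add (hcont μ hμ _ p.continuous) (hcont μ hμ _ q.continuous),
        integral_add (hcont ν hν _ p.continuous) (hcont ν hν _ q.continuous), hp, hq]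
    | monomial n a => simp only [Polynomial.eval_monomial, integral_const_mul, h n]
  have hbound : ∀ (ρ : Measure ℝ) [IsFiniteMeasure ρ], (∀ᵐ x ∂ρ, x ∈ Set.Icc (-R) R) →
      ∀ (f : C_c(ℝ, ℝ)) (p : ℝ[X]) (ε : ℝ), (∀ x ∈ Set.Icc (-R) R, |p.eval x - f x| < ε) →
      |∫ x, p.eval x ∂ρ - ∫ x, f x ∂ρ| ≤ ε * ρ.real Set.univ := by
    intro ρ _ hρ f p ε hp
    rw [← integral_sub (hcont ρ hρ _ p.continuous) (hcont ρ hρ f f.continuous), ← Real.norm_eq_abs]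
    exact norm_integral_le_of_norm_le_const (hρ.mono fun x hx => (hp x hx).le)
  refine Measure.ext_of_integral_eq_on_compactlySupported fun f => ?_
  refine eq_of_abs_sub_le_all fun ε hε => ?_
  -- The `+ 1` keeps the denominator positive when both measures vanish.
  have hC : 0 < μ.real Set.univ + ν.real Set.univ + 1 := by positivity
  obtain ⟨p, hp⟩ := exists_polynomial_near_of_continuousOn (-R) R f f.continuous.continuousOn
    (ε / (μ.real Set.univ + ν.real Set.univ + 1)) (by positivity)
  have h1 := hbound μ hμ f p _ hp
  have h2 := hbound ν hν f p _ hp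
  rw [hpoly p] at h1
  have h3 : ε / (μ.real Set.univ + ν.real Set.univ + 1) * (μ.real Set.univ + ν.real Set.univ)
      ≤ ε := by
    rw [div_mul_eq_mul_div, div_le_iff₀ hC]
    nlinarith
  rw [abs_le] at h1 h2 ⊢
  constructor <;> linarith [h1.1, h1.2, h2.1, h2.2]

/-- The cosine pulls back Lebesgue null sets to Lebesgue null sets. -/
theorem volume_cos_preimage_eq_zero {N : Set ℝ} (hN : volume N = 0) :
    volume (Real.cos ⁻¹' N) = 0 := by
  have h0 : volume (Real.arccos '' (N ∩ Set.Ioo (-1) 1)) = 0 := by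
    refine addHaar_image_eq_zero_of_differentiableOn_of_addHaar_eq_zero _ ?_
      (measure_mono_null Set.inter_subset_left hN)
    intro x hx
    exact (Real.differentiableAt_arccos.2 ⟨hx.2.1.ne', hx.2.2.ne⟩).differentiableWithinAt
  -- `arccos` is not differentiable at `±1`, but two points have a finite image.
  have h1 : volume (Real.arccos '' (N ∩ {-1, 1})) = 0 :=
    (((Set.toFinite _).subset Set.inter_subset_right).image _).measure_zero _
  set A := Real.arccos '' (N ∩ Set.Ioo (-1) 1) ∪ Real.arccos '' (N ∩ {-1, 1}) with hA
  have hA0 : volume A = 0 := measure_union_null h0 h1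
  have hsub : Real.cos ⁻¹' N ⊆ ⋃ k : ℤ, ((fun x => 2 * k * Real.pi + x) '' A ∪
      (fun x => 2 * k * Real.pi - x) '' A) := by
    intro θ hθ
    have hm : Real.arccos (Real.cos θ) ∈ A := by
      rcases eq_or_ne (Real.cos θ) (-1) with h | h
      · exact Or.inr ⟨_, ⟨hθ, by simp [h]⟩, rfl⟩
      rcases eq_or_ne (Real.cos θ) 1 with h' | h'
      · exact Or.inr ⟨_, ⟨hθ, by simp [h']⟩, rfl⟩
      · exact Or.inl ⟨_, ⟨hθ, lt_of_le_of_ne (Real.neg_one_le_cos θ) h.symm,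
          lt_of_le_of_ne (Real.cos_le_one θ) h'⟩, rfl⟩
    obtain ⟨k, hk⟩ := Real.cos_eq_cos_iff.1
      (Real.cos_arccos (Real.neg_one_le_cos θ) (Real.cos_le_one θ))
    refine Set.mem_iUnion.2 ⟨k, ?_⟩
    rcases hk with hk | hk
    · exact Or.inl ⟨_, hm, hk.symm⟩
    · exact Or.inr ⟨_, hm, hk.symm⟩
  refine measure_mono_null hsub (measure_iUnion_null fun k => measure_union_null ?_ ?_)
  · exact addHaar_image_eq_zero_of_differentiableOn_of_addHaar_eq_zero _ (by fun_prop) hA0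
  · exact addHaar_image_eq_zero_of_differentiableOn_of_addHaar_eq_zero _ (by fun_prop) hA0

/-! ### Spectral measures of a bounded self-adjoint operator -/

section SpectralMeasureLemmas

variable {E : Type*} [NormedAddCommGroup E] [InnerProductSpace ℂ E] [CompleteSpace E]

instance regular_spectralMeasure (T : E →L[ℂ] E) (hT : IsSelfAdjoint T) (ψ : E) :
    (spectralMeasure T hT ψ).Regular :=
  RealRMK.regular_rieszMeasure _

/-- A cutoff `f` with values in `[0, 1]` has `‖f(T)‖ ≤ 1`; exhaust the line by compact sets. -/
theorem spectralMeasure_univ_le (T : E →L[ℂ] E) (hT : IsSelfAdjoint T) (ψ : E) :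
    spectralMeasure T hT ψ Set.univ ≤ ENNReal.ofReal (‖ψ‖ ^ 2) := by
  rw [isOpen_univ.measure_eq_iSup_isCompact]
  refine iSup₂_le fun K _ => iSup_le fun hK => ?_
  obtain ⟨f, hf1, hf2, -, hf4⟩ :=
    exists_continuousMap_one_of_isCompact_subset_isOpen hK isOpen_univ (Set.subset_univ K)
  let g : C_c(ℝ, ℝ) := ⟨f, hasCompactSupport_def.mpr hf2⟩
  refine (RealRMK.rieszMeasure_le_of_eq_one (spectralFunctional T hT ψ) (f := g)
    (fun x => (hf4 x).1) hK hf1).trans (ENNReal.ofReal_le_ofReal ?_)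
  have h1 : ‖cfc (g : ℝ → ℝ) T‖ ≤ 1 := norm_cfc_le zero_le_one fun x _ => by
    change ‖f x‖ ≤ 1
    rw [Real.norm_of_nonneg (hf4 x).1]
    exact (hf4 x).2
  calc (inner ℂ ψ (cfc (g : ℝ → ℝ) T ψ)).re ≤ ‖ψ‖ * ‖cfc (g : ℝ → ℝ) T ψ‖ :=
        (Complex.re_le_norm _).trans (norm_inner_le_norm _ _)
    _ ≤ ‖ψ‖ * (1 * ‖ψ‖) := by
        gcongr
        exact ContinuousLinearMap.le_of_opNorm_le _ h1 ψ
    _ = ‖ψ‖ ^ 2 := by ring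

instance isFiniteMeasure_spectralMeasure (T : E →L[ℂ] E) (hT : IsSelfAdjoint T) (ψ : E) :
    IsFiniteMeasure (spectralMeasure T hT ψ) :=
  ⟨(spectralMeasure_univ_le T hT ψ).trans_lt ENNReal.ofReal_lt_top⟩

/-- A bump function supported off the spectrum is sent to `0` by the functional calculus. -/
theorem ae_mem_of_spectrum_subset (T : E →L[ℂ] E) (hT : IsSelfAdjoint T) (ψ : E)
    {s : Set ℝ} (hs : IsClosed s) (hTs : spectrum ℝ T ⊆ s) :
    ∀ᵐ x ∂(spectralMeasure T hT ψ), x ∈ s := by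
  rw [ae_iff]
  change spectralMeasure T hT ψ sᶜ = 0
  rw [hs.isOpen_compl.measure_eq_iSup_isCompact, ← nonpos_iff_eq_zero]
  refine iSup₂_le fun K hKs => iSup_le fun hK => ?_
  obtain ⟨f, hf1, hf2, hf3, hf4⟩ :=
    exists_continuousMap_one_of_isCompact_subset_isOpen hK hs.isOpen_compl hKs
  let g : C_c(ℝ, ℝ) := ⟨f, hasCompactSupport_def.mpr hf2⟩
  refine (RealRMK.rieszMeasure_le_of_eq_one (spectralFunctional T hT ψ) (f := g)
    (fun x => (hf4 x).1) hK hf1).trans ?_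
  have h1 : cfc (g : ℝ → ℝ) T = cfc (fun _ : ℝ => (0 : ℝ)) T := cfc_congr fun x hx =>
    image_eq_zero_of_notMem_tsupport (f := f) fun hx' => hf3 hx' (hTs hx)
  have h2 : (inner ℂ ψ (cfc (g : ℝ → ℝ) T ψ)).re = 0 := by
    rw [h1, cfc_const_zero]
    simp
  exact (congrArg ENNReal.ofReal h2).le.trans (by simp)

theorem exists_spectrum_subset_Icc (T : E →L[ℂ] E) :
    ∃ R : ℝ, spectrum ℝ T ⊆ Set.Icc (-R) R :=
  ⟨‖T‖ * ‖(1 : E →L[ℂ] E)‖, fun x hx => abs_le.1 (by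
    simpa using spectrum.subset_closedBall_norm_mul T hx)⟩

/-- Multiplying by a cutoff equal to `1` on the spectrum changes neither side. This gives access to
moments. -/
theorem integral_spectralMeasure_of_continuous (T : E →L[ℂ] E) (hT : IsSelfAdjoint T) (ψ : E)
    {f : ℝ → ℝ} (hf : Continuous f) :
    ∫ x, f x ∂(spectralMeasure T hT ψ) = (inner ℂ ψ (cfc f T ψ)).re := by
  obtain ⟨R, hR⟩ := exists_spectrum_subset_Icc T
  obtain ⟨χ, hχ1, hχ2, -, -⟩ := exists_continuousMap_one_of_isCompact_subset_isOpen
    (isCompact_Icc (a := -R) (b := R)) isOpen_univ (Set.subset_univ _)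
  let g : C_c(ℝ, ℝ) := ⟨⟨fun x => χ x * f x, by fun_prop⟩,
    HasCompactSupport.mul_right (hasCompactSupport_def.mpr hχ2)⟩
  have hg : ∀ x ∈ Set.Icc (-R) R, f x = g x := fun x hx => by
    change f x = χ x * f x
    rw [hχ1 hx]
    simp
  rw [integral_congr_ae ((ae_mem_of_spectrum_subset T hT ψ isClosed_Icc hR).mono hg),
    integral_spectralMeasure, cfc_congr fun x hx => hg x (hR hx)]

theorem integral_pow_spectralMeasure (T : E →L[ℂ] E) (hT : IsSelfAdjoint T) (ψ : E) (k : ℕ) :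
    ((∫ x, x ^ k ∂(spectralMeasure T hT ψ) : ℝ) : ℂ) = inner ℂ ψ ((T ^ k) ψ) := by
  rw [integral_spectralMeasure_of_continuous T hT ψ (continuous_pow k), cfc_pow_id T k]
  have h : IsSelfAdjoint (T ^ k) := hT.pow k
  exact Complex.conj_eq_iff_re.1 (by
    rw [inner_conj_symm]
    exact (ContinuousLinearMap.isSelfAdjoint_iff_isSymmetric.1 h) ψ ψ)

/-- Quasi-triangle inequality for spectral measures. -/
theorem spectralMeasure_add_le (T : E →L[ℂ] E) (hT : IsSelfAdjoint T) (φ ψ : E) :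
    spectralMeasure T hT (φ + ψ) ≤
      (2 : ℝ≥0∞) • spectralMeasure T hT φ + (2 : ℝ≥0∞) • spectralMeasure T hT ψ := by
  have : IsFiniteMeasure ((2 : ℝ≥0∞) • spectralMeasure T hT φ) :=
    Measure.smul_finite _ (by simp)
  have : IsFiniteMeasure ((2 : ℝ≥0∞) • spectralMeasure T hT ψ) :=
    Measure.smul_finite _ (by simp)
  refine measure_le_of_integral_le fun f hf => ?_
  rw [integral_add_measure f.integrable f.integrable, integral_smul_measure,
    integral_smul_measure]
  simp only [integral_spectralMeasure, ENNReal.toReal_ofNat, smul_eq_mul]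
  have h0 : 0 ≤ cfc (⇑f) T := cfc_nonneg fun x _ => hf x
  -- Positivity at `φ - ψ` bounds the cross terms, as in the parallelogram law.
  have h1 := (Complex.le_def.1
    (((ContinuousLinearMap.nonneg_iff_isPositive _).1 h0).inner_nonneg_right (φ - ψ))).1
  simp only [map_add, map_sub, inner_add_left, inner_add_right, inner_sub_left, inner_sub_right,
    Complex.add_re, Complex.sub_re, Complex.zero_re] at h1 ⊢
  linarith

/-- The vectors whose spectral measure is absolutely continuous. -/
def acVectors (T : E →L[ℂ] E) (hT : IsSelfAdjoint T) : Set E :=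
  {ψ | spectralMeasure T hT ψ ≪ (volume : Measure ℝ)}

theorem zero_mem_acVectors (T : E →L[ℂ] E) (hT : IsSelfAdjoint T) : 0 ∈ acVectors T hT := by
  intro s _
  have h := spectralMeasure_univ_le T hT (0 : E)
  simp only [norm_zero, ne_eq, OfNat.ofNat_ne_zero, not_false_eq_true, zero_pow,
    ENNReal.ofReal_zero, nonpos_iff_eq_zero] at h
  exact measure_mono_null (Set.subset_univ s) h

theorem add_mem_acVectors (T : E →L[ℂ] E) (hT : IsSelfAdjoint T) {φ ψ : E}
    (hφ : φ ∈ acVectors T hT) (hψ : ψ ∈ acVectors T hT) : φ + ψ ∈ acVectors T hT := by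
  intro s hs
  have h := spectralMeasure_add_le T hT φ ψ s
  simpa [hφ hs, hψ hs] using h

/-- If `s` is null and `ψ` is in the set, then `μ_φ(s) ≤ 2 μ_{φ-ψ}(s) ≤ 2 ‖φ - ψ‖²`, which can be
made arbitrarily small. -/
theorem isClosed_acVectors (T : E →L[ℂ] E) (hT : IsSelfAdjoint T) :
    IsClosed (acVectors T hT) := by
  refine isClosed_of_closure_subset fun φ hφ s hs => ?_
  rw [← nonpos_iff_eq_zero]
  refine ENNReal.le_of_forall_pos_le_add fun ε hε _ => ?_
  obtain ⟨ψ, hψ, hd⟩ := Metric.mem_closure_iff.1 hφ (Real.sqrt (ε / 2)) (by positivity)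
  have h := spectralMeasure_add_le T hT ψ (φ - ψ) s
  rw [add_sub_cancel] at h
  have h2 : spectralMeasure T hT (φ - ψ) s ≤ ENNReal.ofReal (ε / 2) := by
    refine (measure_mono (Set.subset_univ s)).trans ((spectralMeasure_univ_le T hT _).trans
      (ENNReal.ofReal_le_ofReal ?_))
    rw [dist_eq_norm] at hd
    exact (Real.le_sqrt (norm_nonneg _) (by positivity)).1 hd.le
  refine h.trans ?_
  have h3 : spectralMeasure T hT ψ s = 0 := hψ hs
  simp only [Measure.coe_add, Measure.coe_smul, Pi.add_apply, Pi.smul_apply, h3, smul_eq_mul,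
    mul_zero, zero_add]
  calc 2 * spectralMeasure T hT (φ - ψ) s ≤ 2 * ENNReal.ofReal (ε / 2) := by gcongr
    _ = ε := by
      rw [← ENNReal.ofReal_ofNat 2, ← ENNReal.ofReal_mul (by norm_num),
        mul_div_cancel₀ _ (by norm_num), ENNReal.ofReal_coe_nnreal]

end SpectralMeasureLemmas

/-! ### Adding an independent `-2 cos θ` -/

noncomputable section

/-- The uniform probability measure on `(0, 2π]`. -/
def uniformAngle : Measure ℝ :=
  ENNReal.ofReal (2 * Real.pi)⁻¹ • volume.restrict (Set.Ioc 0 (2 * Real.pi))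

instance : IsFiniteMeasure uniformAngle :=
  Measure.smul_finite _ ENNReal.ofReal_ne_top

theorem uniformAngle_absolutelyContinuous : uniformAngle ≪ volume :=
  Measure.smul_absolutelyContinuous.trans Measure.restrict_le_self.absolutelyContinuous

theorem ae_uniformAngle_mem : ∀ᵐ θ ∂uniformAngle, θ ∈ Set.Icc 0 (2 * Real.pi) :=
  Measure.ae_smul_measure ((ae_restrict_mem measurableSet_Ioc).mono fun _ h =>
    Set.Ioc_subset_Icc_self h) _

theorem integral_exp_uniformAngle (n : ℤ) :
    ∫ θ, Complex.exp (n * θ * Complex.I) ∂uniformAngle = if n = 0 then 1 else 0 := by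
  have hpi : (0 : ℝ) ≤ 2 * Real.pi := by positivity
  rw [uniformAngle, integral_smul_measure, ENNReal.toReal_ofReal (by positivity),
    ← intervalIntegral.integral_of_le hpi]
  split_ifs with h
  · subst h
    have hpi' : (Real.pi : ℂ) ≠ 0 := Complex.ofReal_ne_zero.2 Real.pi_ne_zero
    simp [field]
  · have hc : (n * Complex.I : ℂ) ≠ 0 := by simp [h]
    have h1 : ∀ θ : ℝ, (n * θ * Complex.I : ℂ) = n * Complex.I * θ := fun θ => by ring
    have h2 : (n * Complex.I * ((2 * Real.pi : ℝ) : ℂ) : ℂ) = n * (2 * Real.pi * Complex.I) := by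
      push_cast
      ring
    simp only [h1]
    rw [integral_exp_mul_complex hc, h2, Complex.exp_int_mul_two_pi_mul_I]
    simp

/-- The law of `x - 2 cos θ`, where `x` has law `μ` and `θ` is an independent uniform angle. -/
def cosConvolution (μ : Measure ℝ) : Measure ℝ :=
  (μ.prod uniformAngle).map fun z => z.1 - 2 * Real.cos z.2

theorem measurable_sub_two_mul_cos :
    Measurable fun z : ℝ × ℝ => z.1 - 2 * Real.cos z.2 :=
  (by fun_prop : Continuous fun z : ℝ × ℝ => z.1 - 2 * Real.cos z.2).measurable

/-- By Fubini it suffices that for each fixed `x` the angles with `x - 2 cos θ` in a null set form a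
null set. -/
theorem cosConvolution_absolutelyContinuous (μ : Measure ℝ) :
    cosConvolution μ ≪ volume := by
  refine Measure.AbsolutelyContinuous.mk fun s hs hs0 => ?_
  have hm := measurable_sub_two_mul_cos
  rw [cosConvolution, Measure.map_apply hm hs, Measure.measure_prod_null (hm hs)]
  refine Filter.Eventually.of_forall fun x => uniformAngle_absolutelyContinuous ?_
  have h0 : volume ((fun c : ℝ => x - 2 * c) ⁻¹' s) = 0 := by
    refine measure_mono_null (t := (fun y : ℝ => (x - y) / 2) '' s) (fun c hc => ⟨_, hc, ?_⟩)
      (addHaar_image_eq_zero_of_differentiableOn_of_addHaar_eq_zero _ (by fun_prop) hs0)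
    simp
  exact volume_cos_preimage_eq_zero h0

section CommutingSum

variable {E : Type*} [NormedAddCommGroup E] [InnerProductSpace ℂ E] [CompleteSpace E]

/-- Let `U` be a representation of `ℤ` commuting with the self-adjoint operator `K`. If `K ^ a ψ` is
orthogonal to `U n ψ` in the sense that `⟨ψ, U n K ^ a ψ⟩ = 0` for all `n ≠ 0`, then the moments of
`K - U 1 - U (-1)` at `ψ` are those of a convolution. -/
theorem inner_pow_sub_translations {K H : E →L[ℂ] E} (hK : IsSelfAdjoint K)
    (U : ℤ → E →L[ℂ] E) (hU0 : U 0 = 1) (hUadd : ∀ m n, U (m + n) = U m * U n)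
    (hUK : ∀ n, U n * K = K * U n) (hH : H = K - U 1 - U (-1)) {ψ : E}
    (hψ : ∀ n, n ≠ 0 → ∀ a : ℕ, inner ℂ ψ (U n ((K ^ a) ψ)) = 0) (k : ℕ) (n : ℤ) (a : ℕ) :
    inner ℂ ψ ((U n * K ^ a * H ^ k) ψ) =
      ∫ z : ℝ × ℝ, Complex.exp (n * z.2 * Complex.I) * (z.1 : ℂ) ^ a *
        ((z.1 - 2 * Real.cos z.2 : ℝ) : ℂ) ^ k ∂((spectralMeasure K hK ψ).prod uniformAngle) := by
  have hcont : ∀ F : ℝ × ℝ → ℂ, Continuous F →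
      Integrable F ((spectralMeasure K hK ψ).prod uniformAngle) := by
    intro F hF
    obtain ⟨R, hR⟩ := exists_spectrum_subset_Icc K
    have h1 := ae_mem_of_spectrum_subset K hK ψ isClosed_Icc hR
    have h2 : ∀ᵐ z ∂((spectralMeasure K hK ψ).prod uniformAngle),
        z ∈ Set.Icc (-R) R ×ˢ Set.Icc 0 (2 * Real.pi) :=
      (Measure.quasiMeasurePreserving_fst.ae h1).and
        (Measure.quasiMeasurePreserving_snd.ae ae_uniformAngle_mem)
    rw [← Measure.restrict_eq_self_of_ae_mem h2]
    exact hF.continuousOn.integrableOn_compact (isCompact_Icc.prod isCompact_Icc)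
  -- Peeling off one factor `H` changes `n` by `±1` or raises `a`, so both must vary.
  induction k generalizing n a with
  | zero =>
    have h1 := integral_prod_mul (μ := spectralMeasure K hK ψ) (ν := uniformAngle)
      (fun x : ℝ => (x : ℂ) ^ a) (fun θ : ℝ => Complex.exp (n * θ * Complex.I))
    simp only [pow_zero, mul_one]
    simp_rw [mul_comm (Complex.exp _)]
    rw [h1, integral_exp_uniformAngle]
    have h2 : ∫ x : ℝ, (x : ℂ) ^ a ∂(spectralMeasure K hK ψ) = inner ℂ ψ ((K ^ a) ψ) := by
      rw [← integral_pow_spectralMeasure K hK ψ a, ← integral_complex_ofReal]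
      simp
    rw [h2]
    split_ifs with h
    · simp [h, hU0]
    · simpa using hψ n h a
  | succ k ih =>
    have hcomm : ∀ m, K ^ a * U m = U m * K ^ a := fun m =>
      (Commute.pow_right (show Commute (U m) K from hUK m) a).eq.symm
    -- Operator counterpart of multiplying the integrand by `x - exp (iθ) - exp (-iθ)`.
    have hop : U n * K ^ a * H ^ (k + 1) = U n * K ^ (a + 1) * H ^ k
        - U (n + 1) * K ^ a * H ^ k - U (n + -1) * K ^ a * H ^ k := by
      rw [pow_succ' H, hUadd, hUadd, pow_succ K]
      nth_rewrite 1 [hH]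
      simp only [mul_sub, sub_mul, ← mul_assoc]
      rw [mul_assoc (U n) (K ^ a) (U 1), mul_assoc (U n) (K ^ a) (U (-1)), hcomm, hcomm]
      simp only [← mul_assoc]
    rw [hop, sub_apply, sub_apply, inner_sub_right, inner_sub_right, ih, ih, ih,
      ← integral_sub (hcont _ (by fun_prop)) (hcont _ (by fun_prop)),
      ← integral_sub (hcont _ (by fun_prop)) (hcont _ (by fun_prop))]
    refine integral_congr_ae (Filter.Eventually.of_forall fun z => ?_)
    have e1 : Complex.exp ((n + 1 : ℤ) * z.2 * Complex.I) =
        Complex.exp (n * z.2 * Complex.I) * Complex.exp (z.2 * Complex.I) := by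
      rw [← Complex.exp_add]
      push_cast
      ring_nf
    have e2 : Complex.exp ((n + -1 : ℤ) * z.2 * Complex.I) =
        Complex.exp (n * z.2 * Complex.I) * Complex.exp (-z.2 * Complex.I) := by
      rw [← Complex.exp_add]
      push_cast
      ring_nf
    have e3 : ((z.1 - 2 * Real.cos z.2 : ℝ) : ℂ) =
        z.1 - (Complex.exp (z.2 * Complex.I) + Complex.exp (-z.2 * Complex.I)) := by
      push_cast
      rw [Complex.two_cos]
    simp only [e1, e2, e3]
    ring

theorem spectralMeasure_eq_cosConvolution {K H : E →L[ℂ] E} (hK : IsSelfAdjoint K)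
    (hHs : IsSelfAdjoint H)
    (U : ℤ → E →L[ℂ] E) (hU0 : U 0 = 1) (hUadd : ∀ m n, U (m + n) = U m * U n)
    (hUK : ∀ n, U n * K = K * U n) (hH : H = K - U 1 - U (-1)) {ψ : E}
    (hψ : ∀ n, n ≠ 0 → ∀ a : ℕ, inner ℂ ψ (U n ((K ^ a) ψ)) = 0) :
    spectralMeasure H hHs ψ = cosConvolution (spectralMeasure K hK ψ) := by
  have hm := measurable_sub_two_mul_cos
  have : IsFiniteMeasure (cosConvolution (spectralMeasure K hK ψ)) :=
    inferInstanceAs (IsFiniteMeasure (Measure.map _ _))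
  obtain ⟨R₁, hR₁⟩ := exists_spectrum_subset_Icc H
  obtain ⟨R₂, hR₂⟩ := exists_spectrum_subset_Icc K
  -- The `+ 2` accounts for `|2 cos θ| ≤ 2`.
  refine measure_ext_of_moments (max R₁ (R₂ + 2)) ?_ ?_ fun k => ?_
  · refine ae_mem_of_spectrum_subset H hHs ψ isClosed_Icc (hR₁.trans (Set.Icc_subset_Icc ?_ ?_))
    · exact neg_le_neg (le_max_left _ _)
    · exact le_max_left _ _
  · refine (ae_map_iff hm.aemeasurable measurableSet_Icc).2 ?_
    filter_upwards [Measure.quasiMeasurePreserving_fst.ae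
      (ae_mem_of_spectrum_subset K hK ψ isClosed_Icc hR₂)] with z hz
    have h1 := Real.neg_one_le_cos z.2
    have h2 := Real.cos_le_one z.2
    have h3 := le_max_right R₁ (R₂ + 2)
    constructor <;> linarith [hz.1, hz.2]
  · rw [cosConvolution, integral_map hm.aemeasurable (by fun_prop)]
    have h := inner_pow_sub_translations hK U hU0 hUadd hUK hH hψ k 0 0
    simp only [hU0, pow_zero, mul_one, one_mul, Int.cast_zero, zero_mul, Complex.exp_zero] at h
    rw [← integral_pow_spectralMeasure H hHs ψ k] at h
    have h' : ∀ z : ℝ × ℝ, ((z.1 - 2 * Real.cos z.2 : ℝ) : ℂ) ^ k =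
      (((z.1 - 2 * Real.cos z.2) ^ k : ℝ) : ℂ) := fun z => by norm_cast
    simp only [h'] at h
    rw [integral_complex_ofReal] at h
    exact_mod_cast h

end CommutingSum

end

/-! ### The lattice operators and point masses -/

noncomputable section

section Lattice

/-- Translation by `a` on `ℓ²(ℤ²)`, `(S_a ψ)(p) = ψ(p + a)`. -/
def latticeShift (a : ℤ × ℤ) : lp (fun _ : ℤ × ℤ => ℂ) 2 →L[ℂ] lp (fun _ : ℤ × ℤ => ℂ) 2 :=
  LinearMap.mkContinuous
    { toFun := fun ψ => ⟨fun p => ψ (p + a), memℓp_two_shift ψ.2 a⟩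
      map_add' := fun _ _ => rfl
      map_smul' := fun _ _ => rfl } 1 fun ψ => by
    have h2 : 0 < (2 : ℝ≥0∞).toReal := by norm_num
    rw [one_mul, lp.norm_eq_tsum_rpow h2, lp.norm_eq_tsum_rpow h2]
    exact (congrArg (· ^ (1 / (2 : ℝ≥0∞).toReal))
      ((Equiv.addRight a).tsum_eq fun p => ‖ψ p‖ ^ (2 : ℝ≥0∞).toReal)).le

theorem latticeShift_apply (a : ℤ × ℤ) (ψ : lp (fun _ : ℤ × ℤ => ℂ) 2) (p : ℤ × ℤ) :
    latticeShift a ψ p = ψ (p + a) := rfl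

theorem latticeShift_zero : latticeShift 0 = 1 := by
  ext ψ p
  simp [latticeShift_apply]

theorem latticeShift_add (a b : ℤ × ℤ) :
    latticeShift (a + b) = latticeShift a * latticeShift b := by
  ext ψ p
  simp [latticeShift_apply, add_assoc]

theorem inner_latticeShift_left (a : ℤ × ℤ) (φ ψ : lp (fun _ : ℤ × ℤ => ℂ) 2) :
    inner ℂ (latticeShift a φ) ψ = inner ℂ φ (latticeShift (-a) ψ) := by
  rw [lp.inner_eq_tsum, lp.inner_eq_tsum,
    ← (Equiv.addRight a).tsum_eq fun p => inner ℂ (φ p) (latticeShift (-a) ψ p)]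
  simp [latticeShift_apply]

theorem isSelfAdjoint_latticeShift_add_neg (a : ℤ × ℤ) :
    IsSelfAdjoint (latticeShift a + latticeShift (-a)) := by
  refine ContinuousLinearMap.isSelfAdjoint_iff_isSymmetric.2 fun φ ψ => ?_
  simp only [ContinuousLinearMap.coe_coe, add_apply, inner_add_left, inner_add_right,
    inner_latticeShift_left, neg_neg]
  exact add_comm _ _

theorem schrodinger_apply (V : lp (fun _ : ℤ => ℝ) ∞)
    (ψ : lp (fun _ : ℤ × ℤ => ℂ) 2) (p : ℤ × ℤ) :
    schrodinger V ψ p = -(ψ (p.1 + 1, p.2) + ψ (p.1 - 1, p.2) + ψ (p.1, p.2 + 1)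
      + ψ (p.1, p.2 - 1)) + (V p.1 : ℂ) * ψ p := rfl

/-- The multiplication operator by the potential. -/
def potentialOp (V : lp (fun _ : ℤ => ℝ) ∞) :
    lp (fun _ : ℤ × ℤ => ℂ) 2 →L[ℂ] lp (fun _ : ℤ × ℤ => ℂ) 2 :=
  -- Adding the shifts back to the full operator makes boundedness automatic.
  schrodinger V + (latticeShift (1, 0) + latticeShift (-(1, 0)))
    + (latticeShift (0, 1) + latticeShift (-(0, 1)))

theorem potentialOp_apply (V : lp (fun _ : ℤ => ℝ) ∞)
    (ψ : lp (fun _ : ℤ × ℤ => ℂ) 2) (p : ℤ × ℤ) :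
    potentialOp V ψ p = (V p.1 : ℂ) * ψ p := by
  simp only [potentialOp, add_apply, lp.coeFn_add, Pi.add_apply, schrodinger_apply,
    latticeShift_apply, Prod.add_def, Prod.neg_mk, neg_zero, add_zero, sub_eq_add_neg]
  ring

theorem isSelfAdjoint_potentialOp (V : lp (fun _ : ℤ => ℝ) ∞) :
    IsSelfAdjoint (potentialOp V) := by
  refine ContinuousLinearMap.isSelfAdjoint_iff_isSymmetric.2 fun φ ψ => ?_
  simp only [ContinuousLinearMap.coe_coe, lp.inner_eq_tsum, potentialOp_apply]
  refine tsum_congr fun p => ?_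
  simp only [RCLike.inner_apply, map_mul, Complex.conj_ofReal]
  ring

/-- The part of the Schrödinger operator acting in the first variable. -/
def horizontalOp (V : lp (fun _ : ℤ => ℝ) ∞) :
    lp (fun _ : ℤ × ℤ => ℂ) 2 →L[ℂ] lp (fun _ : ℤ × ℤ => ℂ) 2 :=
  potentialOp V - (latticeShift (1, 0) + latticeShift (-(1, 0)))

theorem horizontalOp_apply (V : lp (fun _ : ℤ => ℝ) ∞)
    (ψ : lp (fun _ : ℤ × ℤ => ℂ) 2) (p : ℤ × ℤ) :
    horizontalOp V ψ p = (V p.1 : ℂ) * ψ p - (ψ (p.1 + 1, p.2) + ψ (p.1 - 1, p.2)) := by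
  simp [horizontalOp, potentialOp_apply, latticeShift_apply, Prod.add_def, sub_eq_add_neg]

theorem isSelfAdjoint_horizontalOp (V : lp (fun _ : ℤ => ℝ) ∞) :
    IsSelfAdjoint (horizontalOp V) :=
  (isSelfAdjoint_potentialOp V).sub (isSelfAdjoint_latticeShift_add_neg _)

theorem schrodinger_eq_horizontalOp_sub (V : lp (fun _ : ℤ => ℝ) ∞) :
    schrodinger V = horizontalOp V - latticeShift (0, 1) - latticeShift (0, -1) := by
  have h : (-(0, 1) : ℤ × ℤ) = (0, -1) := by simp
  rw [horizontalOp, potentialOp, h]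
  abel

theorem isSelfAdjoint_schrodinger (V : lp (fun _ : ℤ => ℝ) ∞) :
    IsSelfAdjoint (schrodinger V) := by
  have h := (isSelfAdjoint_horizontalOp V).sub (isSelfAdjoint_latticeShift_add_neg (0, 1))
  rwa [← sub_sub, show (-(0, 1) : ℤ × ℤ) = (0, -1) by simp,
    ← schrodinger_eq_horizontalOp_sub] at h

theorem latticeShift_mul_horizontalOp (V : lp (fun _ : ℤ => ℝ) ∞) (n : ℤ) :
    latticeShift (0, n) * horizontalOp V = horizontalOp V * latticeShift (0, n) := by
  ext ψ p
  simp [latticeShift_apply, horizontalOp_apply, Prod.add_def]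

/-- Powers of the horizontal operator preserve rows. -/
theorem horizontalOp_pow_apply_eq_zero (V : lp (fun _ : ℤ => ℝ) ∞)
    {ψ : lp (fun _ : ℤ × ℤ => ℂ) 2} {m : ℤ} (hψ : ∀ n, ψ (n, m) = 0) (a : ℕ) (n : ℤ) :
    (horizontalOp V ^ a) ψ (n, m) = 0 := by
  induction a generalizing n with
  | zero => simpa using hψ n
  | succ a ih =>
    rw [pow_succ', mul_apply_eq_comp, horizontalOp_apply]
    simp only [ih, mul_zero, add_zero, sub_zero]

/-- `K ^ a` keeps the point mass in row `p.2`, while the inner product with its translate reads off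
row `p.2 + n`, where it vanishes for `n ≠ 0`. -/
theorem single_mem_acVectors (V : lp (fun _ : ℤ => ℝ) ∞) (p : ℤ × ℤ) (c : ℂ) :
    (lp.single 2 p c : lp (fun _ : ℤ × ℤ => ℂ) 2) ∈
      acVectors (schrodinger V) (isSelfAdjoint_schrodinger V) := by
  change spectralMeasure _ _ _ ≪ volume
  rw [spectralMeasure_eq_cosConvolution (isSelfAdjoint_horizontalOp V)
    (isSelfAdjoint_schrodinger V) (fun n => latticeShift (0, n)) latticeShift_zero
    (fun m n => by rw [← latticeShift_add]; simp) (latticeShift_mul_horizontalOp V)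
    (schrodinger_eq_horizontalOp_sub V)]
  · exact cosConvolution_absolutelyContinuous _
  · intro n hn a
    have h : (horizontalOp V ^ a) (lp.single 2 p c) (p.1, p.2 + n) = 0 :=
      horizontalOp_pow_apply_eq_zero V
        (fun k => lp.single_apply_ne (E := fun _ : ℤ × ℤ => ℂ) 2 p c (j := (k, p.2 + n))
          (by simp [Prod.ext_iff, hn])) a p.1
    rw [lp.inner_single_left, latticeShift_apply, Prod.add_def, add_zero, h, inner_zero_right]

end Lattice

end

theorem theorem1 (V : lp (fun _ : ℤ => ℝ) ∞) : HasPurelyACSpectrum (schrodinger V) := by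
  refine ⟨isSelfAdjoint_schrodinger V, fun ψ => ?_⟩
  -- `ψ` is the norm limit of its finite truncations, which are sums of point masses.
  refine (isClosed_acVectors _ (isSelfAdjoint_schrodinger V)).mem_of_tendsto
    (lp.hasSum_single (by simp) ψ) (Filter.Eventually.of_forall fun s => ?_)
  induction s using Finset.induction_on with
  | empty => simpa using zero_mem_acVectors _ (isSelfAdjoint_schrodinger V)
  | insert p s hp ih =>
    rw [Finset.sum_insert hp]
    exact add_mem_acVectors _ _ (single_mem_acVectors V p (ψ p)) ih
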